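/- For $(\alpha,\beta,\gamma,\delta)\in\mathbb C^4$ let $Q(\alpha,\beta,\gamma,\delta)\subset\mathbb P^3$ be the quartic surface $$y^2zw-4x^3z+3\alpha xzw^2+\beta zw^3+\gamma xz^2w-\tfrac12(\delta z^2w^2+w^4)=0,$$ and let $X(\alpha,\beta,\gamma,\delta)$ be its minimal resolution. Let $N=H\oplus E_8\oplus E_7$, where $H$ is the hyperbolic plane and $E_8$, $E_7$ are negative definite. If $\gamma\neq0$ or $\delta\neq0$, then $X(\alpha,\beta,\gamma,\delta)$ is a K3 surface with a canonical $N$-polarization, i.e. a primitive lattice embedding $i\colon N\hookrightarrow \mathrm{NS}(X)$ whose image contains a pseudo-ample (nef and big) class, described as follows. Let $a_1,\dots,a_{11}$ be the chain of exceptional curves over $P_1=[0,1,0,0]$ (an $A_{11}$ singularity), and let $L_1$, $L_2$ be the proper transforms of the lines $x=w=0$ and $z=w=0$; the chain is numbered so that $L_2$ meets $a_3$ and $L_1$ meets $a_{11}$. The summand $E_8$ is spanned by $a_1,\dots,a_7,L_2$, and $H$ is spanned by $a_9$ and $$f=2a_1+4a_2+6a_3+3L_2+5a_4+4a_5+3a_6+2a_7+a_8,$$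 with isotropic basis $f$, $f+a_9$. If $\gamma\ne0$, the exceptional curves over $P_2=[0,0,1,0]$ form a chain $b_1,\dots,b_5$ numbered so that $L_1$ meets $b_2$, and the summand $E_7$ is spanned by $a_{11},L_1,b_1,\dots,b_5$, the simple roots being sent to these curves. If $\gamma=0$, the exceptional curves over $P_2$ form an $E_6$ diagram with chain $e_1,e_2,e_3,e_5,e_6$ and $e_4$ joined to $e_3$, where $L_1$ meets $e_1$. Then $a_{11},L_1,e_1,\dots,e_6$ span a second copy of $E_8$, and the summand $E_7$ of $N$ is sent to it through a lattice embedding $E_7\hookrightarrow E_8$ that is fixed once and for all, independently of the parameters; the statement holds for each choice of it. Two $N$-polarized K3 surfaces $(X,i)$, $(X',i')$ are isomorphic if there is an isomorphism $g\colon X\to X'$ with $g^*\circ i'=i$. **Proposition.** Let $(\alpha,\beta,\gamma,\delta)\in\mathbb C^4$ with $\gamma\neq0$ or $\delta\neq0$. For every $t\in\mathbb C^*$ the two $N$-polarized K3 surfaces $$X(\alpha,\beta,\gamma,\delta)\quad\text{and}\quad X(t^2\alpha,\,t^3\beta,\,t^5\gamma,\,t^6\delta)$$ are isomorphic. More precisely,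 for every $q\in\mathbb C^*$ with $q^2=t$ the projective automorphism $$\Phi\colon\mathbb P^3\to\mathbb P^3,\qquad [x,y,z,w]\mapsto[q^8x,\,q^9y,\,z,\,q^6w]$$ maps $Q(\alpha,\beta,\gamma,\delta)$ isomorphically onto $Q(t^2\alpha,t^3\beta,t^5\gamma,t^6\delta)$ and lifts to an isomorphism $X(\alpha,\beta,\gamma,\delta)\to X(t^2\alpha,t^3\beta,t^5\gamma,t^6\delta)$ that is compatible with the canonical $N$-polarizations. -/

import Mathlib

open CategoryTheory AlgebraicGeometry MvPolynomial
open scoped DirectSum Matrix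

/-! ### The grading on the quotient of a graded algebra by a homogeneous ideal -/

section GradedQuotient

variable {R A : Type*} [CommRing R] [CommRing A] [Algebra R A] (𝒜 : ℕ → Submodule R A)
  (I : Ideal A)

/-- The induced grading on `A ⧸ I`: the image of the grading of `A`. -/
def quotientGrading (n : ℕ) : Submodule R (A ⧸ I) :=
  (𝒜 n).map (Ideal.Quotient.mkₐ R I).toLinearMap

theorem mk_mem_quotientGrading {n : ℕ} {a : A} (ha : a ∈ 𝒜 n) :
    Ideal.Quotient.mk I a ∈ quotientGrading 𝒜 I n := ⟨a, ha, rfl⟩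

theorem quotientGrading_gradedMonoid [GradedAlgebra 𝒜] :
    SetLike.GradedMonoid (quotientGrading 𝒜 I) where
  one_mem := ⟨1, SetLike.GradedOne.one_mem, rfl⟩
  mul_mem := by
    rintro i j _ _ ⟨a, ha, rfl⟩ ⟨b, hb, rfl⟩
    exact ⟨a * b, SetLike.GradedMul.mul_mem ha hb, rfl⟩

/-- The homogeneous components in `A ⧸ I` of the class of an element of `A`. -/
noncomputable def quotientDecomposeAux [GradedAlgebra 𝒜] :
    A →+ ⨁ n, quotientGrading 𝒜 I n :=
  (DirectSum.toAddMonoid fun n => (DirectSum.of (fun n => quotientGrading 𝒜 I n) n).comp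
    (((Ideal.Quotient.mkₐ R I).toLinearMap.submoduleMap (𝒜 n)).toAddMonoidHom :
      𝒜 n →+ quotientGrading 𝒜 I n)).comp (DirectSum.decomposeAddEquiv 𝒜).toAddMonoidHom

theorem quotientDecomposeAux_of_mem [GradedAlgebra 𝒜] {n : ℕ} {a : A} (ha : a ∈ 𝒜 n) :
    quotientDecomposeAux 𝒜 I a =
      DirectSum.of (fun n => quotientGrading 𝒜 I n) n
        ⟨Ideal.Quotient.mk I a, mk_mem_quotientGrading 𝒜 I ha⟩ := by
  simp only [quotientDecomposeAux, AddMonoidHom.comp_apply, AddEquiv.coe_toAddMonoidHom,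
    DirectSum.decomposeAddEquiv_apply]
  rw [DirectSum.decompose_of_mem 𝒜 ha, DirectSum.toAddMonoid_of]
  rfl

theorem quotientDecomposeAux_apply [GradedAlgebra 𝒜] (a : A) (n : ℕ) :
    ((quotientDecomposeAux 𝒜 I a n : quotientGrading 𝒜 I n) : A ⧸ I) =
      Ideal.Quotient.mk I (DirectSum.decompose 𝒜 a n) := by
  induction a using DirectSum.Decomposition.inductionOn 𝒜 with
  | zero => simp
  | @homogeneous i m =>
    rw [quotientDecomposeAux_of_mem 𝒜 I m.2, DirectSum.decompose_coe]
    by_cases h : i = n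
    · subst h; simp
    · rw [DirectSum.of_eq_of_ne _ _ _ (Ne.symm h), DirectSum.of_eq_of_ne _ _ _ (Ne.symm h)]; simp
  | add a b ha hb => simp [ha, hb]

/-- The decomposition of `A ⧸ I` into homogeneous components. -/
noncomputable def quotientDecompose [GradedAlgebra 𝒜] (hI : I.IsHomogeneous 𝒜) :
    (A ⧸ I) →+ ⨁ n, quotientGrading 𝒜 I n :=
  QuotientAddGroup.lift I.toAddSubgroup (quotientDecomposeAux 𝒜 I) (by
    intro a ha
    rw [AddMonoidHom.mem_ker]
    ext n
    rw [quotientDecomposeAux_apply]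
    simpa [Ideal.Quotient.eq_zero_iff_mem] using hI n ha)

theorem quotientDecompose_mk [GradedAlgebra 𝒜] (hI : I.IsHomogeneous 𝒜) (a : A) :
    quotientDecompose 𝒜 I hI (Ideal.Quotient.mk I a) = quotientDecomposeAux 𝒜 I a := rfl

/-- The quotient of a graded algebra by a homogeneous ideal is a graded algebra. -/
@[reducible]
noncomputable def quotientGradedAlgebra [GradedAlgebra 𝒜] (hI : I.IsHomogeneous 𝒜) :
    GradedAlgebra (quotientGrading 𝒜 I) :=
  { quotientGrading_gradedMonoid 𝒜 I with
    toDecomposition := DirectSum.Decomposition.ofAddHom _ (quotientDecompose 𝒜 I hI)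
      (by
        ext x
        obtain ⟨a, rfl⟩ := Ideal.Quotient.mk_surjective x
        rw [AddMonoidHom.comp_apply, quotientDecompose_mk, AddMonoidHom.id_apply]
        induction a using DirectSum.Decomposition.inductionOn 𝒜 with
        | zero => simp
        | homogeneous m =>
          rw [quotientDecomposeAux_of_mem 𝒜 I m.2, DirectSum.coeAddMonoidHom_of]
        | add a b ha hb => simp [ha, hb])
      (by
        ext n ⟨x, a, ha, rfl⟩ : 2
        simp only [AddMonoidHom.comp_apply, DirectSum.coeAddMonoidHom_of, AddMonoidHom.id_apply]
        exact (quotientDecompose_mk 𝒜 I hI a).trans (quotientDecomposeAux_of_mem 𝒜 I ha)) }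

end GradedQuotient

/-! ### Orders of vanishing under isomorphisms -/

section Ord

theorem ringOrd_ringEquiv {R R' : Type*} [CommRing R] [CommRing R'] (φ : R ≃+* R') (a : R) :
    Ring.ord R' (φ a) = Ring.ord R a := by
  let _ : Algebra R R' := φ.toRingHom.toAlgebra
  have h : Function.Surjective (algebraMap R R') := φ.surjective
  rw [Ring.ord, Ring.ord]
  have e : (R ⧸ Ideal.span {a}) ≃ₗ[R] (R' ⧸ Ideal.span {φ a}) :=
    (Ideal.quotientEquivAlg (Ideal.span {a}) (Ideal.span {φ a})
      (AlgEquiv.ofRingEquiv (f := φ) (fun _ => rfl)) (by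
        rw [Ideal.map_span, Set.image_singleton]; rfl)).toLinearEquiv
  rw [e.length_eq, Module.length_eq_of_surjective h]

theorem ordFrac_ringEquiv {R R' K K' : Type*} [CommRing R] [CommRing R'] [IsDomain R] [IsDomain R']
    [Field K] [Field K']
    [Algebra R K] [Algebra R' K'] [IsFractionRing R K] [IsFractionRing R' K']
    [IsNoetherianRing R] [IsNoetherianRing R'] [Ring.KrullDimLE 1 R] [Ring.KrullDimLE 1 R']
    (φ : R ≃+* R') (ψ : K →+* K') (h : ∀ a, ψ (algebraMap R K a) = algebraMap R' K' (φ a)) (g : K) :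
    Ring.ordFrac R' (ψ g) = Ring.ordFrac R g := by
  obtain ⟨a, b, hb, rfl⟩ := IsFractionRing.div_surjective (A := R) g
  have key : ∀ a : R,
      Ring.ordFrac R' (algebraMap R' K' (φ a)) = Ring.ordFrac R (algebraMap R K a) := by
    intro a
    by_cases ha : a = 0
    · simp [ha]
    have ha' : φ a ≠ 0 := by simpa using ha
    rw [Ring.ordFrac_eq_ord R' ha', Ring.ordFrac_eq_ord R ha,
      Ring.ordMonoidWithZeroHom_eq_ord (mem_nonZeroDivisors_of_ne_zero ha'),
      Ring.ordMonoidWithZeroHom_eq_ord (mem_nonZeroDivisors_of_ne_zero ha), ringOrd_ringEquiv]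
  rw [map_div₀, map_div₀, map_div₀, h, h, key, key]

/-- The map of function fields induced by an isomorphism of integral schemes. -/
noncomputable def functionFieldMap {X Y : Scheme.{0}} [IsIntegral X] [IsIntegral Y] (e : X ⟶ Y)
    [IsIso e] : Y.functionField →+* X.functionField :=
  (Y.presheaf.stalkSpecializes
    (specializes_of_eq (genericPoint_eq_of_isOpenImmersion e)) ≫
      e.stalkMap (genericPoint X)).hom

theorem functionFieldMap_algebraMap {X Y : Scheme.{0}} [IsIntegral X] [IsIntegral Y] (e : X ⟶ Y)
    [IsIso e] (x : X) (a : Y.presheaf.stalk (e x)) :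
    functionFieldMap e (algebraMap _ _ a) =
      algebraMap (X.presheaf.stalk x) X.functionField ((e.stalkMap x).hom a) := by
  have h := Scheme.Hom.stalkSpecializes_stalkMap e (genericPoint X) x
    ((genericPoint_spec X).specializes trivial)
  have h2 := congr(($h).hom a)
  simp only [CommRingCat.hom_comp, RingHom.comp_apply] at h2
  refine Eq.trans ?_ h2
  simp only [functionFieldMap, CommRingCat.hom_comp, RingHom.comp_apply]
  congr 1
  change (Y.presheaf.stalkSpecializes _ ≫ Y.presheaf.stalkSpecializes _).hom a = _
  rw [TopCat.Presheaf.stalkSpecializes_comp]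

theorem ord_functionFieldMap {X Y : Scheme.{0}} [IsIntegral X] [IsIntegral Y] (e : X ⟶ Y)
    [IsIso e] [IsLocallyNoetherian X] [IsLocallyNoetherian Y] (g : Y.functionField) (x : X) :
    Scheme.ord (functionFieldMap e g) x = Scheme.ord g (e x) := by
  have hc := coheight_eq_of_isOpenImmersion e (x := x)
  by_cases hx : Order.coheight x = 1
  · have hx' : Order.coheight (e x) = 1 := hc.trans hx
    rw [Scheme.ord_eq_ordHom_of_coheight_eq_one hx, Scheme.ord_eq_ordHom_of_coheight_eq_one hx']
    congr 2
    have : Ring.KrullDimLE 1 (X.presheaf.stalk x) := krullDimLE_of_coheight_le hx.le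
    have : Ring.KrullDimLE 1 (Y.presheaf.stalk (e x)) := krullDimLE_of_coheight_le hx'.le
    exact ordFrac_ringEquiv (asIso (e.stalkMap x)).commRingCatIsoToRingEquiv (functionFieldMap e)
      (functionFieldMap_algebraMap e x) g
  · rw [Scheme.ord_eq_zero_of_coheight_neq_one hx, Scheme.ord_eq_zero_of_coheight_neq_one (hc ▸ hx)]

instance isIso_over_left {B : Scheme.{0}} {X Y : Over B} (f : X ⟶ Y) [IsIso f] : IsIso f.left :=
  inferInstanceAs (IsIso ((Over.forget B).map f))

end Ord

noncomputable section

/-! ### Projective space and the quartic surfaces -/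

/-- The homogeneous coordinate ring of `ℙ³`; the variables `X 0`, `X 1`, `X 2`, `X 3` are the
coordinates `x`, `y`, `z`, `w`. -/
abbrev PolyRing : Type := MvPolynomial (Fin 4) ℂ

abbrev polyGrading : ℕ → Submodule ℂ PolyRing := homogeneousSubmodule (Fin 4) ℂ

instance polyGradedAlgebra : GradedAlgebra polyGrading := MvPolynomial.gradedAlgebra

/-- `ℙ³` over `ℂ`. -/
def ProjectiveThreeSpace : Over (Spec (.of ℂ)) :=
  Over.mk (Proj.toSpecZero polyGrading ≫
    Spec.map (CommRingCat.ofHom (algebraMap ℂ (polyGrading 0))))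

/-- `y²zw - 4x³z + 3αxzw² + βzw³ + γxz²w - (1/2)(δz²w² + w⁴)`. -/
def quarticForm (α β γ δ : ℂ) : PolyRing :=
  X 1 ^ 2 * X 2 * X 3 - 4 * X 0 ^ 3 * X 2 + 3 * C α * X 0 * X 2 * X 3 ^ 2 + C β * X 2 * X 3 ^ 3
    + C γ * X 0 * X 2 ^ 2 * X 3 - C (1 / 2) * (C δ * X 2 ^ 2 * X 3 ^ 2 + X 3 ^ 4)

theorem quarticForm_isHomogeneous (α β γ δ : ℂ) : (quarticForm α β γ δ).IsHomogeneous 4 := by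
  have hX : ∀ i : Fin 4, (X i : PolyRing).IsHomogeneous 1 := fun i => isHomogeneous_X ℂ i
  have hC : ∀ a : ℂ, (C a : PolyRing).IsHomogeneous 0 := fun a => isHomogeneous_C _ a
  have h4 : (4 : PolyRing).IsHomogeneous 0 := hC 4
  have h3 : (3 : PolyRing).IsHomogeneous 0 := hC 3
  unfold quarticForm
  refine ((((IsHomogeneous.sub ?_ ?_).add ?_).add ?_).add ?_).sub ?_
  · exact (((hX 1).pow 2).mul (hX 2)).mul (hX 3)
  · exact (h4.mul ((hX 0).pow 3)).mul (hX 2)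
  · exact (((h3.mul (hC α)).mul (hX 0)).mul (hX 2)).mul ((hX 3).pow 2)
  · exact ((hC β).mul (hX 2)).mul ((hX 3).pow 3)
  · exact (((hC γ).mul (hX 0)).mul ((hX 2).pow 2)).mul (hX 3)
  · exact (hC _).mul ((((hC δ).mul ((hX 2).pow 2)).mul ((hX 3).pow 2)).add ((hX 3).pow 4))

def quarticIdeal (α β γ δ : ℂ) : Ideal PolyRing := Ideal.span {quarticForm α β γ δ}

/-- The grading of the homogeneous coordinate ring of the quartic. -/
abbrev quarticGrading (α β γ δ : ℂ) : ℕ → Submodule ℂ (PolyRing ⧸ quarticIdeal α β γ δ) :=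
  quotientGrading polyGrading (quarticIdeal α β γ δ)

instance quarticGradedAlgebra (α β γ δ : ℂ) : GradedAlgebra (quarticGrading α β γ δ) :=
  quotientGradedAlgebra _ _ (Ideal.homogeneous_span _ _ (by
    rintro _ rfl
    exact ⟨4, quarticForm_isHomogeneous α β γ δ⟩))

def quarticQuotientHom (α β γ δ : ℂ) : polyGrading →+*ᵍ quarticGrading α β γ δ where
  __ := Ideal.Quotient.mk (quarticIdeal α β γ δ)
  map_mem h := mk_mem_quotientGrading _ _ h

theorem quarticQuotientHom_irrelevant (α β γ δ : ℂ) :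
    HomogeneousIdeal.irrelevant (quarticGrading α β γ δ) ≤
      (HomogeneousIdeal.irrelevant polyGrading).map (quarticQuotientHom α β γ δ) := by
  rw [HomogeneousIdeal.irrelevant_le]
  rintro i hi _ ⟨a, ha, rfl⟩
  exact Ideal.mem_map_of_mem _ (HomogeneousIdeal.mem_irrelevant_of_mem _ hi ha)

/-- The inclusion in `ℙ³` of the quartic surface, on the level of schemes. -/
def quarticInclusion (α β γ δ : ℂ) : Proj (quarticGrading α β γ δ) ⟶ Proj polyGrading :=
  Proj.map (quarticQuotientHom α β γ δ) (quarticQuotientHom_irrelevant α β γ δ)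

/-- The projective quartic surface `Q(α, β, γ, δ)` over `ℂ`. -/
def Quartic (α β γ δ : ℂ) : Over (Spec (.of ℂ)) :=
  Over.mk (quarticInclusion α β γ δ ≫ ProjectiveThreeSpace.hom)

/-- The inclusion `Q(α, β, γ, δ) ⟶ ℙ³`. -/
def Quartic.ι (α β γ δ : ℂ) : Quartic α β γ δ ⟶ ProjectiveThreeSpace :=
  Over.homMk (quarticInclusion α β γ δ) rfl

/-- The substitution `X i ↦ c i * X i` for nonzero complex numbers `c i`. -/
def scaleHom (c : Fin 4 → ℂˣ) : polyGrading →+*ᵍ polyGrading where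
  __ := (aeval fun i => C (c i : ℂ) * X i : PolyRing →ₐ[ℂ] PolyRing).toRingHom
  map_mem {n x} h := by
    have h' : x.IsHomogeneous n := h
    have := IsHomogeneous.aeval h' (fun i => (C (c i : ℂ) * X i : PolyRing)) (n := 1) (fun i => by
      simpa using (isHomogeneous_C (Fin 4) (c i : ℂ)).mul (isHomogeneous_X ℂ i))
    rw [one_mul] at this
    exact this

theorem scaleHom_scaleHom_inv (c : Fin 4 → ℂˣ) (p : PolyRing) :
    scaleHom c (scaleHom c⁻¹ p) = p := by
  have h : ((aeval fun i => C (c i : ℂ) * X i : PolyRing →ₐ[ℂ] PolyRing)).comp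
    (aeval fun i => C ((c⁻¹ i : ℂˣ) : ℂ) * X i : PolyRing →ₐ[ℂ] PolyRing) = AlgHom.id ℂ _ := by
    ext1 i
    simp only [AlgHom.comp_apply, aeval_X, map_mul, AlgHom.id_apply, ← algebraMap_eq,
      AlgHom.commutes]
    rw [← mul_assoc, ← map_mul]
    simp
  exact congr($h p)

theorem scaleHom_irrelevant (c : Fin 4 → ℂˣ) :
    HomogeneousIdeal.irrelevant polyGrading ≤
      (HomogeneousIdeal.irrelevant polyGrading).map (scaleHom c) := by
  rw [HomogeneousIdeal.irrelevant_le]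
  intro i hi p hp
  have := Ideal.mem_map_of_mem (scaleHom c)
    (HomogeneousIdeal.mem_irrelevant_of_mem _ hi ((scaleHom c⁻¹).map_mem hp))
  exact (scaleHom_scaleHom_inv c p) ▸ this

/-- The projective transformation `[x, y, z, w] ↦ [c₀ x, c₁ y, c₂ z, c₃ w]` of `ℙ³`. -/
def diagonalMap (c : Fin 4 → ℂˣ) : ProjectiveThreeSpace.left ⟶ ProjectiveThreeSpace.left :=
  (Proj.map (scaleHom c) (scaleHom_irrelevant c) : Proj polyGrading ⟶ Proj polyGrading)

/-! ### Surfaces, divisors and the Néron-Severi group -/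

/-- A non-singular complex projective surface: smooth, proper and integral of dimension two over
`ℂ` (such a surface is automatically projective). -/
structure Surface where
  X : Over (Spec (.of ℂ))
  [integral : IsIntegral X.left]
  [smooth : SmoothOfRelativeDimension 2 X.hom]
  [proper : IsProper X.hom]

namespace Surface

attribute [instance] integral smooth proper

instance (S : Surface) : IsLocallyNoetherian S.X.left :=
  LocallyOfFiniteType.isLocallyNoetherian S.X.hom

/-- Irreducible curves on the surface, given by their generic points. -/
abbrev PrimeDivisor (S : Surface) : Type := {x : S.X.left // Order.coheight x = 1}

abbrev Div (S : Surface) : Type := S.PrimeDivisor →₀ ℤ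

/-- The group of divisors of rational functions. -/
def principal (S : Surface) : AddSubgroup S.Div :=
  AddSubgroup.closure {D | ∃ g : S.X.left.functionField, g ≠ 0 ∧ ∀ C, D C = Scheme.ord g C.1}

/-- Divisors modulo linear equivalence. On a K3 surface linear, algebraic and numerical
equivalence coincide, and this is the Néron-Severi group. -/
def NS (S : Surface) : Type := S.Div ⧸ S.principal

instance (S : Surface) : AddCommGroup S.NS := inferInstanceAs (AddCommGroup (S.Div ⧸ S.principal))

/-- The class of a divisor. -/
def cls (S : Surface) : S.Div →+ S.NS := QuotientAddGroup.mk' S.principal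

/-- The class of an irreducible curve. -/
def curveClass {S : Surface} (C : S.PrimeDivisor) : S.NS := S.cls (Finsupp.single C 1)

/-- The image of curves under an isomorphism of surfaces. -/
def mapCurve {S T : Surface} (f : S.X ≅ T.X) : S.PrimeDivisor ≃ T.PrimeDivisor where
  toFun C := ⟨f.hom.left C.1, (coheight_eq_of_isOpenImmersion f.hom.left).trans C.2⟩
  invFun C := ⟨f.inv.left C.1, (coheight_eq_of_isOpenImmersion f.inv.left).trans C.2⟩
  left_inv C := Subtype.ext (by
    change (f.hom ≫ f.inv).left C.1 = _
    simp)
  right_inv C := Subtype.ext (by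
    change (f.inv ≫ f.hom).left C.1 = _
    simp)

/-- The pull-back of divisors along an isomorphism. -/
def pullbackDiv {S T : Surface} (f : S.X ≅ T.X) : T.Div →+ S.Div :=
  Finsupp.mapDomain.addMonoidHom (mapCurve f).symm

theorem pullbackDiv_principal {S T : Surface} (f : S.X ≅ T.X) :
    T.principal ≤ S.principal.comap (pullbackDiv f) := by
  rw [principal, AddSubgroup.closure_le]
  rintro D ⟨g, hg, hD⟩
  refine AddSubgroup.subset_closure ⟨functionFieldMap f.hom.left g, by simpa using hg, fun C => ?_⟩
  rw [ord_functionFieldMap]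
  refine Eq.trans ?_ (hD (mapCurve f C))
  rw [pullbackDiv, Finsupp.mapDomain.addMonoidHom_apply, Finsupp.mapDomain_equiv_apply]
  simp

/-- The pull-back `f^* : NS(T) → NS(S)` along an isomorphism `f : S ≅ T`. -/
def pullback {S T : Surface} (f : S.X ≅ T.X) : T.NS →+ S.NS :=
  QuotientAddGroup.map _ _ (pullbackDiv f) (pullbackDiv_principal f)

/-- The ideal of the curve `C` in the local ring at `p`. -/
def localIdeal {S : Surface} (C : S.PrimeDivisor) (p : S.X.left) :
    Ideal (S.X.left.presheaf.stalk p) :=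
  open scoped Classical in
  if h : C.1 ⤳ p then
    (IsLocalRing.maximalIdeal (S.X.left.presheaf.stalk C.1)).comap
      (S.X.left.presheaf.stalkSpecializes h).hom
  else ⊤

/-- The local intersection multiplicity at `p` of two distinct curves. -/
def localMultiplicity {S : Surface} (C D : S.PrimeDivisor) (p : S.X.left) : ℕ :=
  (Module.length (S.X.left.presheaf.stalk p)
    (S.X.left.presheaf.stalk p ⧸ (localIdeal C p ⊔ localIdeal D p))).toNat

/-- The intersection number of two distinct curves. -/
def curveIntersection {S : Surface} (C D : S.PrimeDivisor) : ℤ :=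
  ∑ᶠ p : S.X.left, (localMultiplicity C D p : ℤ)

/-- `c · d = n`: the intersection number of two classes, computed on representatives without
common components. -/
def HasIntersection {S : Surface} (c d : S.NS) (n : ℤ) : Prop :=
  ∃ D E : S.Div, S.cls D = c ∧ S.cls E = d ∧ Disjoint D.support E.support ∧
    (D.sum fun C k => E.sum fun C' l => k * l * curveIntersection C C') = n

/-- Nef and big. -/
def IsPseudoAmple {S : Surface} (c : S.NS) : Prop :=
  (∀ (C : S.PrimeDivisor) (n : ℤ), HasIntersection c (curveClass C) n → 0 ≤ n) ∧
    ∃ n : ℤ, 0 < n ∧ HasIntersection c c n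

/-- The field of rational functions. -/
abbrev FunctionField (S : Surface) : Type := S.X.left.functionField

instance (S : Surface) : Algebra ℂ S.FunctionField :=
  RingHom.toAlgebra <| (S.X.left.presheaf.germ ⊤ (genericPoint S.X.left) trivial).hom.comp <|
    S.X.hom.appTop.hom.comp (Scheme.ΓSpecIso (.of ℂ)).inv.hom

/-- The local ring at `x` as a subring of the function field. -/
def localSubring (S : Surface) (x : S.X.left) : Subring S.FunctionField :=
  (algebraMap (S.X.left.presheaf.stalk x) S.X.left.functionField).range

/-- The canonical bundle is trivial: some rational 2-form `ω` is regular and nowhere zero, i.e. it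
generates at each point `x` the module of regular 2-forms over the local ring at `x`. -/
def HasTrivialCanonicalBundle (S : Surface) : Prop :=
  ∃ ω : ⋀[S.FunctionField]^2 Ω[S.FunctionField⁄ℂ], ∀ x : S.X.left,
    Submodule.span (S.localSubring x) {η : ⋀[S.FunctionField]^2 Ω[S.FunctionField⁄ℂ] |
      ∃ a ∈ S.localSubring x, ∃ b ∈ S.localSubring x,
        η = exteriorPower.ιMulti S.FunctionField 2
          ![KaehlerDifferential.D ℂ S.FunctionField a, KaehlerDifferential.D ℂ S.FunctionField b]} =
    Submodule.span (S.localSubring x) {ω}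

/-- The structure sheaf as a sheaf of abelian groups. -/
def structureSheafAb (S : Surface) :
    Sheaf (Opens.grothendieckTopology S.X.left) AddCommGrpCat.{0} :=
  (sheafCompose (Opens.grothendieckTopology S.X.left)
    (forget₂ CommRingCat.{0} RingCat.{0} ⋙ forget₂ RingCat.{0} AddCommGrpCat.{0})).obj
    S.X.left.sheaf

/-- A K3 surface: trivial canonical bundle and `H¹(S, 𝒪) = 0`. -/
structure IsK3 (S : Surface) : Prop where
  canonical : S.HasTrivialCanonicalBundle
  irregularity : Subsingleton (Sheaf.H S.structureSheafAb 1)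

end Surface

/-! ### Lattice polarizations -/

/-- The underlying group of the lattice `N = H ⊕ E₈ ⊕ E₇`. -/
abbrev LatticeN : Type := (Fin 2 → ℤ) × (Fin 8 → ℤ) × (Fin 7 → ℤ)

/-- The bilinear form of `N`, with `H` the hyperbolic plane and `E₈`, `E₇` negative definite. -/
def latticeForm (v w : LatticeN) : ℤ :=
  v.1 ⬝ᵥ (!![0, 1; 1, 0] *ᵥ w.1) - v.2.1 ⬝ᵥ (CartanMatrix.E₈ *ᵥ w.2.1)
    - v.2.2 ⬝ᵥ (CartanMatrix.E₇ *ᵥ w.2.2)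

/-- An `N`-polarized K3 surface: a K3 surface with a primitive lattice embedding
`N ↪ NS` whose image contains a pseudo-ample class. (As `N` is non-degenerate, a map that
preserves the forms is injective.) -/
structure NPolarizedK3 where
  S : Surface
  isK3 : S.IsK3
  i : LatticeN →+ S.NS
  isometry : ∀ v w, Surface.HasIntersection (i v) (i w) (latticeForm v w)
  primitive : ∀ (n : ℤ) (c : S.NS), n ≠ 0 → n • c ∈ i.range → c ∈ i.range
  pseudoAmple : ∃ v, Surface.IsPseudoAmple (i v)

/-- An isomorphism `f` carries `i'` to `i`: `f^* ∘ i' = i`. -/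
def RespectsPolarization {S S' : Surface} (f : S.X ≅ S'.X) (i : LatticeN →+ S.NS)
    (i' : LatticeN →+ S'.NS) : Prop :=
  (Surface.pullback f).comp i' = i

def NPolarizedK3.Isomorphic (P P' : NPolarizedK3) : Prop :=
  ∃ f : P.S.X ≅ P'.S.X, RespectsPolarization f P.i P'.i

/-! ### Minimal resolutions -/

/-- A resolution of singularities: a proper birational morphism from a non-singular surface. -/
structure IsResolution {Y : Over (Spec (.of ℂ))} (S : Surface) (π : S.X ⟶ Y) : Prop where
  proper : IsProper π.left
  birational : ∃ U : Y.left.Opens, Dense (U : Set Y.left) ∧ IsIso (π.left ∣_ U)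

/-- The minimal resolution: every resolution factors uniquely through it. -/
structure IsMinimalResolution {Y : Over (Spec (.of ℂ))} (S : Surface) (π : S.X ⟶ Y) : Prop where
  isResolution : IsResolution S π
  minimal : ∀ (T : Surface) (ρ : T.X ⟶ Y), IsResolution T ρ → ∃! g : T.X ⟶ S.X, g ≫ π = ρ

/-! ### The canonical polarization -/

section Canonical

variable {α β γ δ : ℂ} {S : Surface}

/-- The homogeneous prime ideal of `ℂ[x, y, z, w]` of the image in `ℙ³` of the curve `C`. -/
def imageIdeal (π : S.X ⟶ Quartic α β γ δ) (C : S.PrimeDivisor) : Ideal PolyRing :=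
  ((quarticInclusion α β γ δ (π.left C.1) : Proj polyGrading) :
    ProjectiveSpectrum polyGrading).asHomogeneousIdeal.toIdeal

/-- Two curves have a point in common. -/
def Meet (C D : S.PrimeDivisor) : Prop := ∃ p : S.X.left, C.1 ⤳ p ∧ D.1 ⤳ p

/-- The curves on a resolution of the quartic from which the polarization is built: the chain
`a 0, …, a 10` (`a₁, …, a₁₁` in the usual numbering) of exceptional curves over
`P₁ = [0, 1, 0, 0]`, the exceptional curves `b j` over `P₂ = [0, 0, 1, 0]`, and the proper
transforms `L₁`, `L₂` of the lines `x = w = 0` and `z = w = 0`. In the dual diagram `L₂` is joined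
to `a 2`, and `L₁` to `a 10` and `b j₀`; the edges between the `b j` are given by `adj`. -/
structure CurveConfiguration (π : S.X ⟶ Quartic α β γ δ) {k : ℕ} (j₀ : Fin k)
    (adj : Fin k → Fin k → Prop) where
  a : Fin 11 → S.PrimeDivisor
  b : Fin k → S.PrimeDivisor
  L₁ : S.PrimeDivisor
  L₂ : S.PrimeDivisor
  a_injective : Function.Injective a
  b_injective : Function.Injective b
  a_iff : ∀ D, imageIdeal π D = Ideal.span {X 0, X 2, X 3} ↔ D ∈ Set.range a
  b_iff : ∀ D, imageIdeal π D = Ideal.span {X 0, X 1, X 3} ↔ D ∈ Set.range b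
  L₁_iff : ∀ D, imageIdeal π D = Ideal.span {X 0, X 3} ↔ D = L₁
  L₂_iff : ∀ D, imageIdeal π D = Ideal.span {X 2, X 3} ↔ D = L₂
  meet_a : ∀ i j, i ≠ j → (Meet (a i) (a j) ↔ (i : ℕ) + 1 = j ∨ (j : ℕ) + 1 = i)
  meet_b : ∀ i j, i ≠ j → (Meet (b i) (b j) ↔ adj i j)
  meet_a_b : ∀ i j, ¬ Meet (a i) (b j)
  meet_L₁_a : ∀ i, Meet L₁ (a i) ↔ i = 10
  meet_L₂_a : ∀ i, Meet L₂ (a i) ↔ i = 2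
  meet_L₁_b : ∀ j, Meet L₁ (b j) ↔ j = j₀
  meet_L₂_b : ∀ j, ¬ Meet L₂ (b j)
  meet_L₁_L₂ : ¬ Meet L₁ L₂

/-- The `A₅` diagram: the chain `b₁, …, b₅`. -/
def adjA5 (i j : Fin 5) : Prop := (i : ℕ) + 1 = j ∨ (j : ℕ) + 1 = i

/-- The `E₆` diagram: `e₃` is joined to `e₂`, `e₄`, `e₅`, and moreover `e₁` to `e₂` and `e₅` to
`e₆`. -/
def adjE6 (i j : Fin 6) : Prop :=
  (i, j) ∈ ({(0, 1), (1, 2), (2, 3), (2, 4), (4, 5)} : Set (Fin 6 × Fin 6)) ∨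
    (j, i) ∈ ({(0, 1), (1, 2), (2, 3), (2, 4), (4, 5)} : Set (Fin 6 × Fin 6))

namespace CurveConfiguration

variable {π : S.X ⟶ Quartic α β γ δ} {k : ℕ} {j₀ : Fin k} {adj : Fin k → Fin k → Prop}

/-- `f = 2a₁ + 4a₂ + 6a₃ + 3L₂ + 5a₄ + 4a₅ + 3a₆ + 2a₇ + a₈`. -/
def fiberClass (K : CurveConfiguration π j₀ adj) : S.NS :=
  (2 : ℤ) • Surface.curveClass (K.a 0) + (4 : ℤ) • Surface.curveClass (K.a 1)
    + (6 : ℤ) • Surface.curveClass (K.a 2) + (3 : ℤ) • Surface.curveClass K.L₂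
    + (5 : ℤ) • Surface.curveClass (K.a 3) + (4 : ℤ) • Surface.curveClass (K.a 4)
    + (3 : ℤ) • Surface.curveClass (K.a 5) + (2 : ℤ) • Surface.curveClass (K.a 6)
    + Surface.curveClass (K.a 7)

/-- The first `E₈`: `a₁, …, a₇, L₂`, in the order of the nodes of `CartanMatrix.E₈`. -/
def firstE8 (K : CurveConfiguration π j₀ adj) : Fin 8 → S.PrimeDivisor :=
  ![K.a 0, K.L₂, K.a 1, K.a 2, K.a 3, K.a 4, K.a 5, K.a 6]

/-- The `E₇` for `γ ≠ 0`: `a₁₁, L₁, b₁, …, b₅`, in the order of the nodes of `CartanMatrix.E₇`. -/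
def secondE7 {j₀ : Fin 5} {adj : Fin 5 → Fin 5 → Prop} (K : CurveConfiguration π j₀ adj) :
    Fin 7 → S.PrimeDivisor :=
  ![K.a 10, K.b 0, K.L₁, K.b 1, K.b 2, K.b 3, K.b 4]

/-- The second `E₈` for `γ = 0`: `a₁₁, L₁, e₁, …, e₆`, in the order of the nodes of
`CartanMatrix.E₈`. -/
def secondE8 {j₀ : Fin 6} {adj : Fin 6 → Fin 6 → Prop} (K : CurveConfiguration π j₀ adj) :
    Fin 8 → S.PrimeDivisor :=
  ![K.b 5, K.b 3, K.b 4, K.b 2, K.b 1, K.b 0, K.L₁, K.a 10]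

/-- On `H ⊕ E₈`: the standard isotropic basis of `H` is sent to `f` and `f + a₉`, and the simple
roots of `E₈` are sent to the curves of the first `E₈` diagram. -/
structure IsMarkingOnM (K : CurveConfiguration π j₀ adj) (i : LatticeN →+ S.NS) : Prop where
  hyperbolic₁ : i (Pi.single 0 1, 0, 0) = K.fiberClass
  hyperbolic₂ : i (Pi.single 1 1, 0, 0) = K.fiberClass + Surface.curveClass (K.a 8)
  e8 : ∀ j, i (0, Pi.single j 1, 0) = Surface.curveClass (K.firstE8 j)

end CurveConfiguration

/-- `ψ` is an embedding of lattices `E₇ ↪ E₈`. -/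
def IsE7Embedding (ψ : (Fin 7 → ℤ) →+ (Fin 8 → ℤ)) : Prop :=
  ∀ v w, ψ v ⬝ᵥ (CartanMatrix.E₈ *ᵥ ψ w) = v ⬝ᵥ (CartanMatrix.E₇ *ᵥ w)

/-- `i` is the canonical map `N → NS` of a resolution of `Q(α, β, γ, δ)`. For `γ ≠ 0` the summand
`E₇` is spanned by `a₁₁, L₁, b₁, …, b₅`. For `γ = 0` these curves are replaced by the `E₈` diagram
`a₁₁, L₁, e₁, …, e₆`, and `E₇` is mapped to its span through the embedding `ψ` of `E₇` in `E₈`. -/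
structure IsCanonicalMarking (ψ : (Fin 7 → ℤ) →+ (Fin 8 → ℤ)) (π : S.X ⟶ Quartic α β γ δ)
    (i : LatticeN →+ S.NS) : Prop where
  of_ne_zero : γ ≠ 0 → ∃ K : CurveConfiguration π (1 : Fin 5) adjA5, K.IsMarkingOnM i ∧
    ∀ j, i (0, 0, Pi.single j 1) = Surface.curveClass (K.secondE7 j)
  of_eq_zero : γ = 0 → ∃ K : CurveConfiguration π (0 : Fin 6) adjE6, K.IsMarkingOnM i ∧
    ∀ v, i (0, 0, v) = ∑ j, ψ v j • Surface.curveClass (K.secondE8 j)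

end Canonical

/-- `P` is the surface `X(α, β, γ, δ)` with its canonical `N`-polarization. -/
def NPolarizedK3.IsModel (P : NPolarizedK3) (ψ : (Fin 7 → ℤ) →+ (Fin 8 → ℤ)) (α β γ δ : ℂ) :
    Prop :=
  ∃ π : P.S.X ⟶ Quartic α β γ δ, IsMinimalResolution P.S π ∧ IsCanonicalMarking ψ π P.i

end

noncomputable section

/-! ### Functoriality of `Proj` -/

/-! Give x, y, z, w the weights 8, 9, 0, 6 in q, and α, β, γ, δ the weights 4, 6, 10, 12 coming from
t = q². Then every monomial of the quartic has weight 24, so substituting Φ into the form with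
scaled parameters gives q²⁴ times the original form (`scaleHom_quarticForm`). Hence Φ restricts to
an isomorphism of quartics over ℂ, and the universal property of minimal resolutions lifts it to an
isomorphism f (`IsMinimalResolution.exists_iso`).

For the polarizations, a diagonal map fixes every ideal generated by coordinates. So f sends L₁ to
L₁ and L₂ to L₂, and permutes the curves over P₁ and those over P₂ up to relabelling. It also
preserves incidence. The diagrams A₁₁, A₅ and E₆ each have a nontrivial symmetry, a reflection, but
none of these fixes the node that meets L₁ (`chain_rigid`, `adjA5_rigid`, `adjE6_rigid`). Therefore
f carries each named curve to the curve of the same name. The two markings are given by the same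
formulas in these curves, and γ and t⁵γ vanish together, so f^* ∘ i' and i agree on generators of N
(`respectsPolarization_of_isCanonicalMarking`). -/

theorem proj_map_congr {A B σ τ : Type} [CommRing A] [SetLike σ A] [AddSubgroupClass σ A]
    [CommRing B] [SetLike τ B] [AddSubgroupClass τ B] {𝒜 : ℕ → σ} {ℬ : ℕ → τ} [GradedRing 𝒜]
    [GradedRing ℬ] {f g : 𝒜 →+*ᵍ ℬ} (h : f = g)
    (hf : HomogeneousIdeal.irrelevant ℬ ≤ (HomogeneousIdeal.irrelevant 𝒜).map f)
    (hg : HomogeneousIdeal.irrelevant ℬ ≤ (HomogeneousIdeal.irrelevant 𝒜).map g) :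
    Proj.map f hf = Proj.map g hg := by
  subst h; rfl

theorem scaleHom_C (c : Fin 4 → ℂˣ) (a : ℂ) : scaleHom c (C a) = C a :=
  (aeval fun i => C (c i : ℂ) * X i : PolyRing →ₐ[ℂ] PolyRing).commutes a

theorem scaleHom_X (c : Fin 4 → ℂˣ) (i : Fin 4) : scaleHom c (X i) = C (c i : ℂ) * X i :=
  aeval_X (R := ℂ) (fun i => (C (c i : ℂ) * X i : PolyRing)) i

theorem scaleHom_inv_scaleHom (c : Fin 4 → ℂˣ) (p : PolyRing) :
    scaleHom c⁻¹ (scaleHom c p) = p := by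
  simpa only [inv_inv] using scaleHom_scaleHom_inv c⁻¹ p

/-- The structure morphism of `ℙ³` as a morphism from `Proj`. -/
def projToSpec : Proj polyGrading ⟶ Spec (.of ℂ) :=
  Proj.toSpecZero polyGrading ≫ Spec.map (CommRingCat.ofHom (algebraMap ℂ (polyGrading 0)))

theorem awayι_projToSpec {n : ℕ} (hn : 0 < n) (p : PolyRing) (hp : p ∈ polyGrading n) :
    Proj.awayι polyGrading p hp hn ≫ projToSpec = Spec.map (CommRingCat.ofHom
      ((HomogeneousLocalization.fromZeroRingHom polyGrading (Submonoid.powers p)).comp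
        (algebraMap ℂ (polyGrading 0)))) := by
  rw [projToSpec, Proj.awayι_toSpecZero_assoc, ← Spec.map_comp]
  rfl

theorem away_map_fromZeroRingHom {A B σ τ : Type*} [CommRing A] [SetLike σ A]
    [AddSubgroupClass σ A] [CommRing B] [SetLike τ B] [AddSubgroupClass τ B] {𝒜 : ℕ → σ}
    {ℬ : ℕ → τ} [GradedRing 𝒜] [GradedRing ℬ] (g : 𝒜 →+*ᵍ ℬ) (p : A) (x : 𝒜 0) :
    HomogeneousLocalization.Away.map g p (HomogeneousLocalization.fromZeroRingHom 𝒜 _ x) =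
      HomogeneousLocalization.fromZeroRingHom ℬ _ ⟨g x, g.map_mem x.2⟩ := by
  apply HomogeneousLocalization.val_injective
  -- Both sides are fractions with numerator g x. The denominators are g 1 and 1.
  change Localization.mk (g x) ⟨g 1, _⟩ = Localization.mk (g x) ⟨1, _⟩
  congr 2
  exact map_one g

theorem awayMap_scaleHom_comp (c : Fin 4 → ℂˣ) (p : PolyRing) :
    (HomogeneousLocalization.Away.map (scaleHom c) p).comp
      ((HomogeneousLocalization.fromZeroRingHom polyGrading (Submonoid.powers p)).comp
        (algebraMap ℂ (polyGrading 0))) =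
      (HomogeneousLocalization.fromZeroRingHom polyGrading
        (Submonoid.powers (scaleHom c p))).comp (algebraMap ℂ (polyGrading 0)) := by
  apply RingHom.ext
  intro a
  refine (away_map_fromZeroRingHom (scaleHom c) p _).trans (congrArg _ (Subtype.ext ?_))
  exact scaleHom_C c a

theorem awayι_map_scaleHom_projToSpec (c : Fin 4 → ℂˣ) {n : ℕ} (hn : 0 < n) (p : PolyRing)
    (hp : p ∈ polyGrading n) :
    Proj.awayι polyGrading (scaleHom c p) ((scaleHom c).map_mem hp) hn ≫
      Proj.map (scaleHom c) (scaleHom_irrelevant c) ≫ projToSpec =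
      Proj.awayι polyGrading (scaleHom c p) ((scaleHom c).map_mem hp) hn ≫ projToSpec := by
  rw [← Category.assoc]
  refine (congrArg (· ≫ projToSpec) (Proj.awayι_comp_map _ _ hn p hp)).trans ?_
  rw [Category.assoc, awayι_projToSpec, awayι_projToSpec,
    ← Spec.map_comp, ← CommRingCat.ofHom_comp, awayMap_scaleHom_comp]

/-- Diagonal maps are morphisms over ℂ because the substitution fixes constants. This is checked on
the affine charts where `scaleHom c p` is invertible, with p homogeneous of positive degree. -/
theorem map_scaleHom_projToSpec (c : Fin 4 → ℂˣ) :
    Proj.map (scaleHom c) (scaleHom_irrelevant c) ≫ projToSpec = projToSpec :=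
  (Proj.mapAffineOpenCover _ (scaleHom_irrelevant c)).openCover.hom_ext _ _ fun s =>
    awayι_map_scaleHom_projToSpec c s.1.2 s.2.1 s.2.2

/-! ### Isomorphisms of quartics -/

section QuarticIso

variable {α β γ δ α' β' γ' δ' : ℂ}

/-- Rings and schemes go in opposite directions: the hypothesis says that the equation of the target
quartic pulls back into the ideal of the source. -/
def quarticScaleHom (c : Fin 4 → ℂˣ)
    (h : scaleHom c (quarticForm α' β' γ' δ') ∈ quarticIdeal α β γ δ) :
    quarticGrading α' β' γ' δ' →+*ᵍ quarticGrading α β γ δ where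
  __ := Ideal.quotientMap (quarticIdeal α β γ δ) (scaleHom c).toRingHom (by
    rw [quarticIdeal, Ideal.span_singleton_le_iff_mem]
    exact h)
  map_mem := by
    rintro n _ ⟨a, ha, rfl⟩
    exact mk_mem_quotientGrading _ _ ((scaleHom c).map_mem ha)

theorem quarticScaleHom_mk (c : Fin 4 → ℂˣ)
    (h : scaleHom c (quarticForm α' β' γ' δ') ∈ quarticIdeal α β γ δ) (p : PolyRing) :
    quarticScaleHom c h (Ideal.Quotient.mk _ p) = Ideal.Quotient.mk _ (scaleHom c p) := rfl

/-- Scaling by c⁻¹ supplies a preimage of the same degree for each homogeneous class, so the map on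
`Proj` is defined everywhere. -/
theorem quarticScaleHom_irrelevant (c : Fin 4 → ℂˣ)
    (h : scaleHom c (quarticForm α' β' γ' δ') ∈ quarticIdeal α β γ δ) :
    HomogeneousIdeal.irrelevant (quarticGrading α β γ δ) ≤
      (HomogeneousIdeal.irrelevant (quarticGrading α' β' γ' δ')).map (quarticScaleHom c h) := by
  rw [HomogeneousIdeal.irrelevant_le]
  rintro i hi _ ⟨a, ha, rfl⟩
  have := Ideal.mem_map_of_mem (quarticScaleHom c h) (HomogeneousIdeal.mem_irrelevant_of_mem
    (quarticGrading α' β' γ' δ') hi (mk_mem_quotientGrading polyGrading (quarticIdeal α' β' γ' δ')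
      ((scaleHom c⁻¹).map_mem ha)))
  rw [GradedRingHom.coe_toRingHom, quarticScaleHom_mk, scaleHom_scaleHom_inv] at this
  exact this

def quarticScaleMap (c : Fin 4 → ℂˣ)
    (h : scaleHom c (quarticForm α' β' γ' δ') ∈ quarticIdeal α β γ δ) :
    Proj (quarticGrading α β γ δ) ⟶ Proj (quarticGrading α' β' γ' δ') :=
  Proj.map (quarticScaleHom c h) (quarticScaleHom_irrelevant c h)

theorem quarticScaleMap_inclusion (c : Fin 4 → ℂˣ)
    (h : scaleHom c (quarticForm α' β' γ' δ') ∈ quarticIdeal α β γ δ) :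
    quarticScaleMap c h ≫ quarticInclusion α' β' γ' δ' =
      quarticInclusion α β γ δ ≫ Proj.map (scaleHom c) (scaleHom_irrelevant c) := by
  rw [quarticScaleMap, quarticInclusion, quarticInclusion, ← Proj.map_comp, ← Proj.map_comp]
  rfl

/-- Two independent scalings c and d are allowed so that one lemma gives both identities of the
isomorphism, with (c, d) equal to (c, c⁻¹) and to (c⁻¹, c). -/
theorem quarticScaleMap_comp_eq_id (c d : Fin 4 → ℂˣ)
    (h : scaleHom c (quarticForm α' β' γ' δ') ∈ quarticIdeal α β γ δ)
    (h' : scaleHom d (quarticForm α β γ δ) ∈ quarticIdeal α' β' γ' δ')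
    (hcd : ∀ p, scaleHom c (scaleHom d p) = p) :
    quarticScaleMap c h ≫ quarticScaleMap d h' = 𝟙 _ := by
  rw [quarticScaleMap, quarticScaleMap, ← Proj.map_comp, ← Proj.map_id]
  refine proj_map_congr ?_ _ _
  ext x
  obtain ⟨p, rfl⟩ := Ideal.Quotient.mk_surjective x
  rw [GradedRingHom.comp_apply, quarticScaleHom_mk, quarticScaleHom_mk, hcd]
  rfl

/-- The isomorphism of schemes underlying `quarticScaleIso`. -/
def quarticScaleSchemeIso (c : Fin 4 → ℂˣ)
    (h : scaleHom c (quarticForm α' β' γ' δ') ∈ quarticIdeal α β γ δ)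
    (h' : scaleHom c⁻¹ (quarticForm α β γ δ) ∈ quarticIdeal α' β' γ' δ') :
    (Quartic α β γ δ).left ≅ (Quartic α' β' γ' δ').left where
  hom := quarticScaleMap c h
  inv := quarticScaleMap c⁻¹ h'
  hom_inv_id := quarticScaleMap_comp_eq_id c c⁻¹ h h' (scaleHom_scaleHom_inv c)
  inv_hom_id := quarticScaleMap_comp_eq_id c⁻¹ c h' h (scaleHom_inv_scaleHom c)

theorem quarticScaleSchemeIso_hom (c : Fin 4 → ℂˣ)
    (h : scaleHom c (quarticForm α' β' γ' δ') ∈ quarticIdeal α β γ δ)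
    (h' : scaleHom c⁻¹ (quarticForm α β γ δ) ∈ quarticIdeal α' β' γ' δ') :
    (quarticScaleSchemeIso c h h').hom ≫ (Quartic α' β' γ' δ').hom = (Quartic α β γ δ).hom := by
  change quarticScaleMap c h ≫ quarticInclusion α' β' γ' δ' ≫ projToSpec =
    quarticInclusion α β γ δ ≫ projToSpec
  rw [← Category.assoc, quarticScaleMap_inclusion, Category.assoc, map_scaleHom_projToSpec]

/-- The isomorphism of quartics induced by a diagonal projective transformation. -/
def quarticScaleIso (c : Fin 4 → ℂˣ)
    (h : scaleHom c (quarticForm α' β' γ' δ') ∈ quarticIdeal α β γ δ)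
    (h' : scaleHom c⁻¹ (quarticForm α β γ δ) ∈ quarticIdeal α' β' γ' δ') :
    Quartic α β γ δ ≅ Quartic α' β' γ' δ' :=
  Over.isoMk (quarticScaleSchemeIso c h h') (quarticScaleSchemeIso_hom c h h')

theorem quarticScaleIso_ι (c : Fin 4 → ℂˣ)
    (h : scaleHom c (quarticForm α' β' γ' δ') ∈ quarticIdeal α β γ δ)
    (h' : scaleHom c⁻¹ (quarticForm α β γ δ) ∈ quarticIdeal α' β' γ' δ') :
    (quarticScaleIso c h h').hom.left ≫ (Quartic.ι α' β' γ' δ').left =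
      (Quartic.ι α β γ δ).left ≫ diagonalMap c :=
  quarticScaleMap_inclusion c h

theorem scaleHom_quarticForm (α β γ δ : ℂ) (t q : ℂˣ) (h : q ^ 2 = t) :
    scaleHom ![q ^ 8, q ^ 9, 1, q ^ 6]
      (quarticForm ((t : ℂ) ^ 2 * α) ((t : ℂ) ^ 3 * β) ((t : ℂ) ^ 5 * γ) ((t : ℂ) ^ 6 * δ)) =
    C ((q : ℂ) ^ 24) * quarticForm α β γ δ := by
  subst h
  -- The numerals are written as constants so that `scaleHom_C` applies to them.
  have h4 : (4 : PolyRing) = C 4 := rfl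
  have h3 : (3 : PolyRing) = C 3 := rfl
  simp only [quarticForm, h3, h4, map_add, map_sub, map_mul, map_pow, scaleHom_C, scaleHom_X]
  simp
  ring

theorem scaleHom_quarticForm_mem (α β γ δ : ℂ) (t q : ℂˣ) (h : q ^ 2 = t) :
    scaleHom ![q ^ 8, q ^ 9, 1, q ^ 6]
      (quarticForm ((t : ℂ) ^ 2 * α) ((t : ℂ) ^ 3 * β) ((t : ℂ) ^ 5 * γ) ((t : ℂ) ^ 6 * δ)) ∈
    quarticIdeal α β γ δ := by
  rw [scaleHom_quarticForm α β γ δ t q h]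
  exact Ideal.mul_mem_left _ _ (Ideal.mem_span_singleton_self _)

/-- Undoing the scaling in `scaleHom_quarticForm` expresses the target form as q²⁴ times the element
in question, and q²⁴ is a unit. -/
theorem scaleHom_inv_quarticForm_mem (α β γ δ : ℂ) (t q : ℂˣ) (h : q ^ 2 = t) :
    scaleHom (![q ^ 8, q ^ 9, 1, q ^ 6] : Fin 4 → ℂˣ)⁻¹ (quarticForm α β γ δ) ∈
    quarticIdeal ((t : ℂ) ^ 2 * α) ((t : ℂ) ^ 3 * β) ((t : ℂ) ^ 5 * γ) ((t : ℂ) ^ 6 * δ) := by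
  have h1 := congrArg (scaleHom (![q ^ 8, q ^ 9, 1, q ^ 6] : Fin 4 → ℂˣ)⁻¹)
    (scaleHom_quarticForm α β γ δ t q h)
  rw [scaleHom_inv_scaleHom, map_mul, scaleHom_C] at h1
  refine (Ideal.unit_mul_mem_iff_mem _ (y := C ((q : ℂ) ^ 24)) ?_).1 ?_
  · exact ((Units.isUnit q).pow 24).map C
  · rw [← h1]
    exact Ideal.mem_span_singleton_self _

end QuarticIso

/-! ### Minimal resolutions -/

theorem isIso_comp_morphismRestrict {X Y Y' : Scheme.{0}} (f : X ⟶ Y) (e : Y ⟶ Y') [IsIso e]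
    (V : Y'.Opens) (h : IsIso (f ∣_ e ⁻¹ᵁ V)) : IsIso ((f ≫ e) ∣_ V) := by
  rw [morphismRestrict_comp]
  exact @IsIso.comp_isIso _ _ _ _ _ (f ∣_ e ⁻¹ᵁ V) (e ∣_ V) h inferInstance

theorem IsResolution.comp_iso {Y Y' : Over (Spec (.of ℂ))} {S : Surface} {π : S.X ⟶ Y}
    (h : IsResolution S π) (φ : Y ≅ Y') : IsResolution S (π ≫ φ.hom) where
  proper := by
    have := h.proper
    rw [Over.comp_left]
    infer_instance
  birational := by
    obtain ⟨U, hU, hU'⟩ := h.birational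
    have e : φ.hom.left ⁻¹ᵁ (φ.inv.left ⁻¹ᵁ U) = U := by
      rw [← Scheme.Hom.comp_preimage, ← Over.comp_left]
      simp
    refine ⟨φ.inv.left ⁻¹ᵁ U, hU.preimage φ.inv.left.homeomorph.isOpenMap, ?_⟩
    have : IsIso φ.hom.left := isIso_over_left φ.hom
    have : IsIso (π.left ∣_ φ.hom.left ⁻¹ᵁ φ.inv.left ⁻¹ᵁ U) :=
      (congrArg (fun V => IsIso (π.left ∣_ V)) e).mpr hU'
    exact isIso_comp_morphismRestrict π.left φ.hom.left _ this

/-- A minimal resolution is terminal among resolutions, and composing with φ turns resolutions of Y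
into resolutions of Y'. Each side thus maps to the other, and both composites are identities by
uniqueness. -/
theorem IsMinimalResolution.exists_iso {Y Y' : Over (Spec (.of ℂ))} {S S' : Surface}
    {π : S.X ⟶ Y} {π' : S'.X ⟶ Y'} (h : IsMinimalResolution S π) (h' : IsMinimalResolution S' π')
    (φ : Y ≅ Y') : ∃ f : S.X ≅ S'.X, f.hom ≫ π' = π ≫ φ.hom := by
  obtain ⟨f, hf, -⟩ := h'.minimal S _ (h.isResolution.comp_iso φ)
  obtain ⟨g, hg, -⟩ := h.minimal S' _ (h'.isResolution.comp_iso φ.symm)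
  rw [Iso.symm_hom] at hg
  refine ⟨⟨f, g, ?_, ?_⟩, hf⟩
  · refine (h.minimal S π h.isResolution).unique ?_ (Category.id_comp _)
    simp [hg, reassoc_of% hf]
  · refine (h'.minimal S' π' h'.isResolution).unique ?_ (Category.id_comp _)
    simp [hf, reassoc_of% hg]

/-! ### The image of a curve under a diagonal transformation -/

theorem span_X_le_comap_scaleHom (c : Fin 4 → ℂˣ) (s : Set (Fin 4)) :
    Ideal.span (X '' s) ≤ (Ideal.span (X '' s) : Ideal PolyRing).comap (scaleHom c) := by
  rw [Ideal.span_le]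
  rintro _ ⟨i, hi, rfl⟩
  rw [SetLike.mem_coe, Ideal.mem_comap, scaleHom_X]
  exact Ideal.mul_mem_left _ _ (Ideal.subset_span ⟨i, hi, rfl⟩)

/-- One inclusion holds because each variable is only multiplied by a constant. The other is the
same inclusion for c⁻¹. -/
theorem comap_scaleHom_span_X (c : Fin 4 → ℂˣ) (s : Set (Fin 4)) :
    (Ideal.span (X '' s) : Ideal PolyRing).comap (scaleHom c) = Ideal.span (X '' s) := by
  refine le_antisymm (fun p hp => ?_) (span_X_le_comap_scaleHom c s)
  have h : scaleHom c⁻¹ (scaleHom c p) ∈ Ideal.span (X '' s) :=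
    Ideal.mem_comap.1 (span_X_le_comap_scaleHom c⁻¹ s (Ideal.mem_comap.1 hp))
  rwa [scaleHom_inv_scaleHom] at h

theorem comap_scaleHom_eq_span_X_iff (c : Fin 4 → ℂˣ) (s : Set (Fin 4)) (J : Ideal PolyRing) :
    J.comap (scaleHom c) = Ideal.span (X '' s) ↔ J = Ideal.span (X '' s) := by
  refine ⟨fun h => ?_, fun h => h ▸ comap_scaleHom_span_X c s⟩
  have hs : Function.Surjective (scaleHom c) := fun p => ⟨_, scaleHom_scaleHom_inv c p⟩
  exact Ideal.comap_injective_of_surjective (scaleHom c) hs (h.trans (comap_scaleHom_span_X c s).symm)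

section Transport

variable {α β γ δ α' β' γ' δ' : ℂ} {S S' : Surface} {π : S.X ⟶ Quartic α β γ δ}
  {π' : S'.X ⟶ Quartic α' β' γ' δ'} {f : S.X ≅ S'.X} {c : Fin 4 → ℂˣ}

/-- `Proj.map` acts on points by taking preimages of homogeneous primes, so evaluating the
commutative square at the generic point of C suffices. -/
theorem imageIdeal_mapCurve
    (h : f.hom.left ≫ π'.left ≫ (Quartic.ι α' β' γ' δ').left =
      π.left ≫ (Quartic.ι α β γ δ).left ≫ diagonalMap c) (C : S.PrimeDivisor) :
    imageIdeal π' (Surface.mapCurve f C) = (imageIdeal π C).comap (scaleHom c) := by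
  have hC : (f.hom.left ≫ π'.left ≫ (Quartic.ι α' β' γ' δ').left) C.1 =
    (π.left ≫ (Quartic.ι α β γ δ).left ≫ diagonalMap c) C.1 := by rw [h]
  exact congrArg (fun p : ProjectiveSpectrum polyGrading => p.asHomogeneousIdeal.toIdeal) hC

theorem imageIdeal_mapCurve_eq_span_X_iff
    (h : f.hom.left ≫ π'.left ≫ (Quartic.ι α' β' γ' δ').left =
      π.left ≫ (Quartic.ι α β γ δ).left ≫ diagonalMap c) (C : S.PrimeDivisor) (s : Set (Fin 4)) :
    imageIdeal π' (Surface.mapCurve f C) = Ideal.span (X '' s) ↔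
      imageIdeal π C = Ideal.span (X '' s) := by
  rw [imageIdeal_mapCurve h, comap_scaleHom_eq_span_X_iff]

theorem meet_mapCurve (f : S.X ≅ S'.X) (C D : S.PrimeDivisor) :
    Meet (Surface.mapCurve f C) (Surface.mapCurve f D) ↔ Meet C D := by
  constructor
  · rintro ⟨p, hC, hD⟩
    refine ⟨f.inv.left p, ?_, ?_⟩
    · have := hC.map f.inv.left.continuous
      rwa [show f.inv.left (Surface.mapCurve f C).1 = C.1 from
        congrArg Subtype.val ((Surface.mapCurve f).left_inv C)] at this
    · have := hD.map f.inv.left.continuous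
      rwa [show f.inv.left (Surface.mapCurve f D).1 = D.1 from
        congrArg Subtype.val ((Surface.mapCurve f).left_inv D)] at this
  · rintro ⟨p, hC, hD⟩
    exact ⟨f.hom.left p, hC.map f.hom.left.continuous, hD.map f.hom.left.continuous⟩

theorem pullback_curveClass (f : S.X ≅ S'.X) (C : S.PrimeDivisor) :
    Surface.pullback f (Surface.curveClass (Surface.mapCurve f C)) = Surface.curveClass C := by
  change S.cls (Surface.pullbackDiv f (Finsupp.single (Surface.mapCurve f C) 1)) = _
  rw [Surface.pullbackDiv, Finsupp.mapDomain.addMonoidHom_apply, Finsupp.mapDomain_single,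
    Equiv.symm_apply_apply]
  rfl

end Transport

/-! ### Rigidity of the diagrams -/

theorem chain_rigid (σ : Fin 11 → Fin 11) (hσ : Function.Injective σ) (h10 : σ 10 = 10)
    (h : ∀ i j, i ≠ j → (((σ i : ℕ) + 1 = σ j ∨ (σ j : ℕ) + 1 = σ i) ↔
      ((i : ℕ) + 1 = j ∨ (j : ℕ) + 1 = i))) (i : Fin 11) : σ i = i := by
  -- Induction on the distance n from the fixed end 10, moving down the chain.
  have key : ∀ n, ∀ i : Fin 11, (i : ℕ) + n = 10 → σ i = i := by
    intro n
    induction n using Nat.strong_induction_on with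
    | _ n ih =>
      intro i hi
      rcases n with - | n
      · have : i = 10 := Fin.ext hi
        rw [this, h10]
      · let k : Fin 11 := ⟨i + 1, by omega⟩
        have hk : σ k = k := ih n (by omega) k (by simp only [k]; omega)
        have hik : (k : ℕ) = i + 1 := rfl
        have h1 := (h i k (fun e => by rw [← e] at hik; omega)).2 (Or.inl hik.symm)
        rw [hk, hik] at h1
        rcases h1 with h1 | h1
        · exact Fin.ext (by omega)
        -- Here σ i = i + 2, so i + 2 ≤ 10 and n ≥ 1; thus `n - 1` is a true subtraction. The node i
        -- + 2 is already fixed, which contradicts injectivity.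
        · let l : Fin 11 := ⟨i + 2, by omega⟩
          have hil : (l : ℕ) = i + 2 := rfl
          have hl : σ l = l := ih (n - 1) (by omega) l (by omega)
          have : i = l := hσ (Fin.ext (by rw [hl, hil]; omega))
          rw [← this] at hil
          omega
  exact key (10 - i) i (by omega)

instance : DecidableRel adjA5 := fun i j => by unfold adjA5; infer_instance

/-- The fixed node is off centre, so the reflection of the chain, which sends 1 to 3, is excluded.
-/
theorem adjA5_rigid (σ : Fin 5 → Fin 5) (hσ : Function.Injective σ) (h1 : σ 1 = 1)
    (h : ∀ i j, i ≠ j → (adjA5 (σ i) (σ j) ↔ adjA5 i j)) (i : Fin 5) : σ i = i := by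
  have step : ∀ i j, i ≠ j → σ i ≠ σ j := fun i j hij => hσ.ne hij
  have adj : ∀ i j, i ≠ j → adjA5 i j → adjA5 (σ i) (σ j) := fun i j hij => (h i j hij).2
  have h10 := adj 1 0 (by decide) (by decide)
  have h12 := adj 1 2 (by decide) (by decide)
  have h23 := adj 2 3 (by decide) (by decide)
  have h34 := adj 3 4 (by decide) (by decide)
  have n02 := step 0 2 (by decide)
  have n13 := step 1 3 (by decide)
  have n24 := step 2 4 (by decide)
  -- Of the two neighbours of node 1, only node 2 has a further neighbour; this tells them apart.
  have a1 : ∀ x y z, adjA5 1 x → adjA5 1 y → adjA5 y z → x ≠ y → 1 ≠ z →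
      x = 0 ∧ y = 2 ∧ z = 3 := by decide
  have a3 : ∀ x, adjA5 3 x → 2 ≠ x → x = 4 := by decide
  rw [h1] at h10 h12 n13
  obtain ⟨e0, e2, e3⟩ := a1 _ _ _ h10 h12 h23 n02 n13
  rw [e3] at h34
  rw [e2] at n24
  have e4 := a3 _ h34 n24
  fin_cases i <;> assumption

instance : DecidableRel adjE6 := fun i j => by
  unfold adjE6
  simp only [Set.mem_insert_iff, Set.mem_singleton_iff]
  infer_instance

/-- The nontrivial symmetry swaps the two long arms and would move the end 0 to the end 5. -/
theorem adjE6_rigid (σ : Fin 6 → Fin 6) (hσ : Function.Injective σ) (h0 : σ 0 = 0)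
    (h : ∀ i j, i ≠ j → (adjE6 (σ i) (σ j) ↔ adjE6 i j)) (i : Fin 6) : σ i = i := by
  have step : ∀ i j, i ≠ j → σ i ≠ σ j := fun i j hij => hσ.ne hij
  have adj : ∀ i j, i ≠ j → adjE6 i j → adjE6 (σ i) (σ j) := fun i j hij => (h i j hij).2
  have h01 := adj 0 1 (by decide) (by decide)
  have h12 := adj 1 2 (by decide) (by decide)
  have h23 := adj 2 3 (by decide) (by decide)
  have h24 := adj 2 4 (by decide) (by decide)
  have h45 := adj 4 5 (by decide) (by decide)
  have n02 := step 0 2 (by decide)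
  have n13 := step 1 3 (by decide)
  have n14 := step 1 4 (by decide)
  have n25 := step 2 5 (by decide)
  have n34 := step 3 4 (by decide)
  have a0 : ∀ x, adjE6 0 x → x = 1 := by decide
  have a1 : ∀ x, adjE6 1 x → 0 ≠ x → x = 2 := by decide
  -- Beyond the branch node 2, nodes 3 and 4 are distinguished because only 4 has another neighbour.
  have a2 : ∀ x y z, adjE6 2 x → adjE6 2 y → adjE6 y z → 1 ≠ x → 1 ≠ y → x ≠ y → 2 ≠ z →
      x = 3 ∧ y = 4 ∧ z = 5 := by decide
  rw [h0] at h01 n02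
  have e1 := a0 _ h01
  rw [e1] at h12 n13 n14
  have e2 := a1 _ h12 n02
  rw [e2] at h23 h24 n25
  obtain ⟨e3, e4, e5⟩ := a2 _ _ _ h23 h24 h45 n13 n14 n34 n25
  fin_cases i <;> assumption

/-! ### Comparison of the canonical markings -/

namespace CurveConfiguration

variable {α β γ δ α' β' γ' δ' : ℂ} {S S' : Surface} {π : S.X ⟶ Quartic α β γ δ}
  {π' : S'.X ⟶ Quartic α' β' γ' δ'} {f : S.X ≅ S'.X} {c : Fin 4 → ℂˣ} {k : ℕ} {j₀ : Fin k}
  {adj : Fin k → Fin k → Prop}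

theorem mapCurve_L₁ (K : CurveConfiguration π j₀ adj) (K' : CurveConfiguration π' j₀ adj)
    (h : f.hom.left ≫ π'.left ≫ (Quartic.ι α' β' γ' δ').left =
      π.left ≫ (Quartic.ι α β γ δ).left ≫ diagonalMap c) :
    Surface.mapCurve f K.L₁ = K'.L₁ := by
  have hs : ({X 0, X 3} : Set PolyRing) = X '' {0, 3} := by simp [Set.image_insert_eq]
  rw [← K'.L₁_iff, hs, imageIdeal_mapCurve_eq_span_X_iff h, ← hs, K.L₁_iff]

theorem mapCurve_L₂ (K : CurveConfiguration π j₀ adj) (K' : CurveConfiguration π' j₀ adj)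
    (h : f.hom.left ≫ π'.left ≫ (Quartic.ι α' β' γ' δ').left =
      π.left ≫ (Quartic.ι α β γ δ).left ≫ diagonalMap c) :
    Surface.mapCurve f K.L₂ = K'.L₂ := by
  have hs : ({X 2, X 3} : Set PolyRing) = X '' {2, 3} := by simp [Set.image_insert_eq]
  rw [← K'.L₂_iff, hs, imageIdeal_mapCurve_eq_span_X_iff h, ← hs, K.L₂_iff]

/-- The curves over P₁ are characterized by their image ideal, so f induces a self-map σ of the
labels. It preserves adjacency, and L₁ pins the end 10, so `chain_rigid` applies. -/
theorem mapCurve_a (K : CurveConfiguration π j₀ adj) (K' : CurveConfiguration π' j₀ adj)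
    (h : f.hom.left ≫ π'.left ≫ (Quartic.ι α' β' γ' δ').left =
      π.left ≫ (Quartic.ι α β γ δ).left ≫ diagonalMap c) (i : Fin 11) :
    Surface.mapCurve f (K.a i) = K'.a i := by
  have hs : ({X 0, X 2, X 3} : Set PolyRing) = X '' {0, 2, 3} := by simp [Set.image_insert_eq]
  have hex : ∀ i, ∃ j, K'.a j = Surface.mapCurve f (K.a i) := fun i => by
    rw [← Set.mem_range, ← K'.a_iff, hs, imageIdeal_mapCurve_eq_span_X_iff h, ← hs, K.a_iff]
    exact Set.mem_range_self i
  choose σ hσ using hex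
  have hinj : Function.Injective σ := fun i j hij =>
    K.a_injective ((Surface.mapCurve f).injective (by rw [← hσ, ← hσ, hij]))
  rw [← hσ, chain_rigid σ hinj]
  · rw [← K'.meet_L₁_a, hσ, ← mapCurve_L₁ K K' h, meet_mapCurve, K.meet_L₁_a]
  · intro i j hij
    rw [← K'.meet_a _ _ (hinj.ne hij), hσ, hσ, meet_mapCurve, K.meet_a _ _ hij]

/-- Rigidity of the diagram is a hypothesis so that the A₅ and E₆ cases share one proof. -/
theorem mapCurve_b (K : CurveConfiguration π j₀ adj) (K' : CurveConfiguration π' j₀ adj)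
    (h : f.hom.left ≫ π'.left ≫ (Quartic.ι α' β' γ' δ').left =
      π.left ≫ (Quartic.ι α β γ δ).left ≫ diagonalMap c)
    (hrigid : ∀ σ : Fin k → Fin k, Function.Injective σ → σ j₀ = j₀ →
      (∀ i j, i ≠ j → (adj (σ i) (σ j) ↔ adj i j)) → ∀ i, σ i = i) (i : Fin k) :
    Surface.mapCurve f (K.b i) = K'.b i := by
  have hs : ({X 0, X 1, X 3} : Set PolyRing) = X '' {0, 1, 3} := by simp [Set.image_insert_eq]
  have hex : ∀ i, ∃ j, K'.b j = Surface.mapCurve f (K.b i) := fun i => by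
    rw [← Set.mem_range, ← K'.b_iff, hs, imageIdeal_mapCurve_eq_span_X_iff h, ← hs, K.b_iff]
    exact Set.mem_range_self i
  choose σ hσ using hex
  have hinj : Function.Injective σ := fun i j hij =>
    K.b_injective ((Surface.mapCurve f).injective (by rw [← hσ, ← hσ, hij]))
  rw [← hσ, hrigid σ hinj]
  · rw [← K'.meet_L₁_b, hσ, ← mapCurve_L₁ K K' h, meet_mapCurve, K.meet_L₁_b]
  · intro i j hij
    rw [← K'.meet_b _ _ (hinj.ne hij), hσ, hσ, meet_mapCurve, K.meet_b _ _ hij]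

theorem pullback_a (K : CurveConfiguration π j₀ adj) (K' : CurveConfiguration π' j₀ adj)
    (h : f.hom.left ≫ π'.left ≫ (Quartic.ι α' β' γ' δ').left =
      π.left ≫ (Quartic.ι α β γ δ).left ≫ diagonalMap c) (i : Fin 11) :
    Surface.pullback f (Surface.curveClass (K'.a i)) = Surface.curveClass (K.a i) := by
  rw [← mapCurve_a K K' h, pullback_curveClass]

theorem pullback_L₁ (K : CurveConfiguration π j₀ adj) (K' : CurveConfiguration π' j₀ adj)
    (h : f.hom.left ≫ π'.left ≫ (Quartic.ι α' β' γ' δ').left =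
      π.left ≫ (Quartic.ι α β γ δ).left ≫ diagonalMap c) :
    Surface.pullback f (Surface.curveClass K'.L₁) = Surface.curveClass K.L₁ := by
  rw [← mapCurve_L₁ K K' h, pullback_curveClass]

theorem pullback_L₂ (K : CurveConfiguration π j₀ adj) (K' : CurveConfiguration π' j₀ adj)
    (h : f.hom.left ≫ π'.left ≫ (Quartic.ι α' β' γ' δ').left =
      π.left ≫ (Quartic.ι α β γ δ).left ≫ diagonalMap c) :
    Surface.pullback f (Surface.curveClass K'.L₂) = Surface.curveClass K.L₂ := by
  rw [← mapCurve_L₂ K K' h, pullback_curveClass]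

theorem pullback_fiberClass (K : CurveConfiguration π j₀ adj)
    (K' : CurveConfiguration π' j₀ adj)
    (h : f.hom.left ≫ π'.left ≫ (Quartic.ι α' β' γ' δ').left =
      π.left ≫ (Quartic.ι α β γ δ).left ≫ diagonalMap c) :
    Surface.pullback f K'.fiberClass = K.fiberClass := by
  simp only [fiberClass, map_add, map_zsmul, pullback_a K K' h, pullback_L₂ K K' h]

theorem pullback_firstE8 (K : CurveConfiguration π j₀ adj)
    (K' : CurveConfiguration π' j₀ adj)
    (h : f.hom.left ≫ π'.left ≫ (Quartic.ι α' β' γ' δ').left =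
      π.left ≫ (Quartic.ι α β γ δ).left ≫ diagonalMap c) (j : Fin 8) :
    Surface.pullback f (Surface.curveClass (K'.firstE8 j)) =
      Surface.curveClass (K.firstE8 j) := by
  fin_cases j
  all_goals first | exact pullback_a K K' h _ | exact pullback_L₂ K K' h

theorem pullback_secondE7 (K : CurveConfiguration π (1 : Fin 5) adjA5)
    (K' : CurveConfiguration π' (1 : Fin 5) adjA5)
    (h : f.hom.left ≫ π'.left ≫ (Quartic.ι α' β' γ' δ').left =
      π.left ≫ (Quartic.ι α β γ δ).left ≫ diagonalMap c) (j : Fin 7) :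
    Surface.pullback f (Surface.curveClass (K'.secondE7 j)) =
      Surface.curveClass (K.secondE7 j) := by
  have hb : ∀ i, Surface.pullback f (Surface.curveClass (K'.b i)) = Surface.curveClass (K.b i) :=
    fun i => by rw [← mapCurve_b K K' h adjA5_rigid, pullback_curveClass]
  fin_cases j
  exacts [pullback_a K K' h _, hb _, pullback_L₁ K K' h, hb _, hb _, hb _, hb _]

theorem pullback_secondE8 (K : CurveConfiguration π (0 : Fin 6) adjE6)
    (K' : CurveConfiguration π' (0 : Fin 6) adjE6)
    (h : f.hom.left ≫ π'.left ≫ (Quartic.ι α' β' γ' δ').left =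
      π.left ≫ (Quartic.ι α β γ δ).left ≫ diagonalMap c) (j : Fin 8) :
    Surface.pullback f (Surface.curveClass (K'.secondE8 j)) =
      Surface.curveClass (K.secondE8 j) := by
  have hb : ∀ i, Surface.pullback f (Surface.curveClass (K'.b i)) = Surface.curveClass (K.b i) :=
    fun i => by rw [← mapCurve_b K K' h adjE6_rigid, pullback_curveClass]
  fin_cases j
  exacts [hb _, hb _, hb _, hb _, hb _, hb _, pullback_L₁ K K' h, pullback_a K K' h _]

end CurveConfiguration

/-! ### Additive maps out of N and the comparison of polarizations -/

theorem addMonoidHom_pi_int_ext {n : ℕ} {A : Type*} [AddCommGroup A] {F G : (Fin n → ℤ) →+ A}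
    (h : ∀ j, F (Pi.single j 1) = G (Pi.single j 1)) : F = G := by
  refine AddMonoidHom.functions_ext' _ _ _ fun j => ?_
  ext
  exact h j

/-- On the last summand agreement is required at all vectors, which suits γ = 0, where the marking
is given through ψ by a formula in v. -/
theorem latticeN_hom_ext {A : Type*} [AddCommGroup A] {F G : LatticeN →+ A}
    (h₁ : ∀ j, F (Pi.single j 1, 0, 0) = G (Pi.single j 1, 0, 0))
    (h₂ : ∀ j, F (0, Pi.single j 1, 0) = G (0, Pi.single j 1, 0))
    (h₃ : ∀ v, F (0, 0, v) = G (0, 0, v)) : F = G := by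
  have e₁ : F.comp (AddMonoidHom.inl _ _) = G.comp (AddMonoidHom.inl _ _) :=
    addMonoidHom_pi_int_ext h₁
  have e₂ : (F.comp (AddMonoidHom.inr _ _)).comp (AddMonoidHom.inl _ _) =
      (G.comp (AddMonoidHom.inr _ _)).comp (AddMonoidHom.inl _ _) := addMonoidHom_pi_int_ext h₂
  have e₃ : (F.comp (AddMonoidHom.inr _ _)).comp (AddMonoidHom.inr _ _) =
      (G.comp (AddMonoidHom.inr _ _)).comp (AddMonoidHom.inr _ _) := AddMonoidHom.ext h₃
  have e₂₃ : F.comp (AddMonoidHom.inr _ _) = G.comp (AddMonoidHom.inr _ _) := by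
    rw [← AddMonoidHom.coprod_unique (F.comp (AddMonoidHom.inr _ _)),
      ← AddMonoidHom.coprod_unique (G.comp (AddMonoidHom.inr _ _)), e₂, e₃]
  rw [← AddMonoidHom.coprod_unique F, ← AddMonoidHom.coprod_unique G, e₁, e₂₃]

theorem respectsPolarization_of_isCanonicalMarking {α β γ δ α' β' γ' δ' : ℂ} {S S' : Surface}
    {π : S.X ⟶ Quartic α β γ δ} {π' : S'.X ⟶ Quartic α' β' γ' δ'} {f : S.X ≅ S'.X}
    {c : Fin 4 → ℂˣ} {ψ : (Fin 7 → ℤ) →+ (Fin 8 → ℤ)} {i : LatticeN →+ S.NS}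
    {i' : LatticeN →+ S'.NS}
    (h : f.hom.left ≫ π'.left ≫ (Quartic.ι α' β' γ' δ').left =
      π.left ≫ (Quartic.ι α β γ δ).left ≫ diagonalMap c) (hγ : γ = 0 ↔ γ' = 0)
    (hi : IsCanonicalMarking ψ π i) (hi' : IsCanonicalMarking ψ π' i') :
    RespectsPolarization f i i' := by
  -- The part on H ⊕ E₈ is common to both cases; only the E₇ summand depends on whether γ vanishes.
  have onM : ∀ {k : ℕ} {j₀ : Fin k} {adj : Fin k → Fin k → Prop}
      (K : CurveConfiguration π j₀ adj) (K' : CurveConfiguration π' j₀ adj),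
      K.IsMarkingOnM i → K'.IsMarkingOnM i' →
      (∀ v, Surface.pullback f (i' (0, 0, v)) = i (0, 0, v)) → RespectsPolarization f i i' := by
    intro k j₀ adj K K' hK hK' h₃
    refine latticeN_hom_ext (fun j => ?_) (fun j => ?_) h₃
    · rw [AddMonoidHom.comp_apply]
      fin_cases j
      · refine (congrArg _ hK'.hyperbolic₁).trans (Eq.trans ?_ hK.hyperbolic₁.symm)
        exact K.pullback_fiberClass K' h
      · refine (congrArg _ hK'.hyperbolic₂).trans (Eq.trans ?_ hK.hyperbolic₂.symm)
        rw [map_add, K.pullback_fiberClass K' h, K.pullback_a K' h]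
    · rw [AddMonoidHom.comp_apply, hK'.e8, hK.e8, K.pullback_firstE8 K' h]
  by_cases h0 : γ = 0
  · obtain ⟨K, hK, hKv⟩ := hi.of_eq_zero h0
    obtain ⟨K', hK', hKv'⟩ := hi'.of_eq_zero (hγ.1 h0)
    refine onM K K' hK hK' fun v => ?_
    simp only [hKv, hKv', map_sum, map_zsmul, K.pullback_secondE8 K' h]
  · obtain ⟨K, hK, hKv⟩ := hi.of_ne_zero h0
    obtain ⟨K', hK', hKv'⟩ := hi'.of_ne_zero (mt hγ.2 h0)
    refine onM K K' hK hK' fun v => ?_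
    -- For γ ≠ 0 the marking is prescribed on the simple roots only, so agreement extends to all of
    -- E₇ by additivity.
    have e : ((Surface.pullback f).comp i').comp
        ((AddMonoidHom.inr (Fin 2 → ℤ) ((Fin 8 → ℤ) × (Fin 7 → ℤ))).comp
          (AddMonoidHom.inr (Fin 8 → ℤ) (Fin 7 → ℤ))) =
        i.comp ((AddMonoidHom.inr (Fin 2 → ℤ) ((Fin 8 → ℤ) × (Fin 7 → ℤ))).comp
          (AddMonoidHom.inr (Fin 8 → ℤ) (Fin 7 → ℤ))) := by
      refine addMonoidHom_pi_int_ext fun j => ?_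
      refine (congrArg _ (hKv' j)).trans (Eq.trans ?_ (hKv j).symm)
      exact K.pullback_secondE7 K' h j
    exact DFunLike.congr_fun e v

end

theorem mainTheorem8 (α β γ δ : ℂ) (h : γ ≠ 0 ∨ δ ≠ 0) (t : ℂˣ)
    (ψ : (Fin 7 → ℤ) →+ (Fin 8 → ℤ)) (hψ : IsE7Embedding ψ) :
    (∀ P P' : NPolarizedK3, P.IsModel ψ α β γ δ →
      P'.IsModel ψ ((t : ℂ) ^ 2 * α) ((t : ℂ) ^ 3 * β) ((t : ℂ) ^ 5 * γ) ((t : ℂ) ^ 6 * δ) →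
      P.Isomorphic P') ∧
    ∀ q : ℂˣ, q ^ 2 = t →
      (∃ φ : Quartic α β γ δ ≅
          Quartic ((t : ℂ) ^ 2 * α) ((t : ℂ) ^ 3 * β) ((t : ℂ) ^ 5 * γ) ((t : ℂ) ^ 6 * δ),
        φ.hom.left ≫ (Quartic.ι _ _ _ _).left =
          (Quartic.ι α β γ δ).left ≫ diagonalMap ![q ^ 8, q ^ 9, 1, q ^ 6]) ∧
      ∀ (S S' : Surface) (π : S.X ⟶ Quartic α β γ δ)
        (π' : S'.X ⟶
          Quartic ((t : ℂ) ^ 2 * α) ((t : ℂ) ^ 3 * β) ((t : ℂ) ^ 5 * γ) ((t : ℂ) ^ 6 * δ)),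
        IsMinimalResolution S π → IsMinimalResolution S' π' →
        ∃ f : S.X ≅ S'.X,
          f.hom.left ≫ π'.left ≫ (Quartic.ι _ _ _ _).left =
            π.left ≫ (Quartic.ι α β γ δ).left ≫ diagonalMap ![q ^ 8, q ^ 9, 1, q ^ 6] ∧
          ∀ (i : LatticeN →+ S.NS) (i' : LatticeN →+ S'.NS),
            IsCanonicalMarking ψ π i → IsCanonicalMarking ψ π' i' →
            RespectsPolarization f i i' := by
  have hγ : γ = 0 ↔ (t : ℂ) ^ 5 * γ = 0 := by simp
  have lift : ∀ q : ℂˣ, q ^ 2 = t → ∀ (S S' : Surface) (π : S.X ⟶ Quartic α β γ δ)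
      (π' : S'.X ⟶
        Quartic ((t : ℂ) ^ 2 * α) ((t : ℂ) ^ 3 * β) ((t : ℂ) ^ 5 * γ) ((t : ℂ) ^ 6 * δ)),
      IsMinimalResolution S π → IsMinimalResolution S' π' →
      ∃ f : S.X ≅ S'.X,
        f.hom.left ≫ π'.left ≫ (Quartic.ι _ _ _ _).left =
          π.left ≫ (Quartic.ι α β γ δ).left ≫ diagonalMap ![q ^ 8, q ^ 9, 1, q ^ 6] ∧
        ∀ (i : LatticeN →+ S.NS) (i' : LatticeN →+ S'.NS),
          IsCanonicalMarking ψ π i → IsCanonicalMarking ψ π' i' →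
          RespectsPolarization f i i' := by
    intro q hq S S' π π' hπ hπ'
    let φ := quarticScaleIso _ (scaleHom_quarticForm_mem α β γ δ t q hq)
      (scaleHom_inv_quarticForm_mem α β γ δ t q hq)
    obtain ⟨f, hf⟩ := hπ.exists_iso hπ' φ
    have hfl : f.hom.left ≫ π'.left = π.left ≫ φ.hom.left := by
      rw [← Over.comp_left, hf, Over.comp_left]
    have h' : f.hom.left ≫ π'.left ≫ (Quartic.ι _ _ _ _).left =
        π.left ≫ (Quartic.ι α β γ δ).left ≫ diagonalMap ![q ^ 8, q ^ 9, 1, q ^ 6] := by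
      rw [← Category.assoc, hfl, Category.assoc, quarticScaleIso_ι]
    exact ⟨f, h', fun i i' hi hi' => respectsPolarization_of_isCanonicalMarking h' hγ hi hi'⟩
  refine ⟨?_, fun q hq => ⟨⟨_, quarticScaleIso_ι _ (scaleHom_quarticForm_mem α β γ δ t q hq)
      (scaleHom_inv_quarticForm_mem α β γ δ t q hq)⟩, lift q hq⟩⟩
  rintro P P' ⟨π, hπ, hi⟩ ⟨π', hπ', hi'⟩
  -- Any square root of t in ℂ serves; it is nonzero because t is.
  obtain ⟨q, hq⟩ : ∃ q : ℂˣ, q ^ 2 = t := by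
    obtain ⟨z, hz⟩ := IsAlgClosed.exists_pow_nat_eq (t : ℂ) (n := 2) (by norm_num)
    have hz0 : z ≠ 0 := fun h0 => t.ne_zero (by rw [← hz, h0]; norm_num)
    exact ⟨Units.mk0 z hz0, Units.ext hz⟩
  obtain ⟨f, -, hf⟩ := lift q hq P.S P'.S π π' hπ hπ'
  exact ⟨f, hf _ _ hi hi'⟩
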